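/- Let $m\ge 2$ and let $(t_k)_{k\in\mathbb Z}$ be a nondecreasing, non-constant sequence of real knots; let $I$ be the convex hull of the set of knots. (A finite partition $x_0<\dots<x_n$ of a compact interval is included by setting $t_k=x_0$ for $k\le 0$, $t_k=x_k$ for $0\le k\le n$ and $t_k=x_n$ for $k\ge n$.) Let $B_j$ be the normalized B-spline of degree $m$ with support $[t_{j-m},t_{j+1}]$ (identically $0$ if $t_{j-m}=t_{j+1}$; if $I$ contains its right end point, the last knot interval of positive length is taken closed on the right). Put $$\theta_j=\frac1m\sum_{r=-m+1}^{0}t_{j+r},\qquad \theta_j^{(2)}=\binom m2^{-1}\sum_{-m+1\le r<s\le 0}t_{j+r}t_{j+s},\qquad A_j=\theta_j^2-\theta_j^{(2)},$$ $$\lambda_j(f)=f(\theta_j)-\tfrac12A_j\,f''(\theta_j),\qquad \mu_j(f)=f(\theta_j)-A_j\,[\theta_{j-1},\theta_j,\theta_{j+1}]f,\qquad Q_2^*f=\sum_{j\in\mathbb Z}\mu_j(f)B_j,$$ where $[\cdot,\cdot,\cdot]f$ is the second-order divided difference, and the second term of $\mu_j$ is omitted when $A_j=0$ (the three points $\theta_{j-1},\theta_j,\theta_{j+1}$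 are distinct whenever $A_j\ne0$). Then: (1) at every point of $I$ only finitely many $B_j$ are nonzero; (2) for every polynomial $p$ of degree at most $2$, $\mu_j(p)=\lambda_j(p)$ for all $j$, and $Q_2^*p=p$ on $I$; (3) $\|Q_2^*\|_\infty\le\left\lfloor\frac{m+4}{2}\right\rfloor$, where $\|Q\|_\infty=\sup\{\sup_I|Qf| : \sup_I|f|\le 1\}$. In particular the operators $Q_2^*$ are bounded uniformly with respect to the knots. -/

import Mathlib

open scoped ENNReal

noncomputable section

namespace SplineQI

/-- A knot sequence is a nondecreasing, non-constant bi-infinite sequence of reals.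
Infinite partitions of `ℝ` (or of any open interval) are the strictly increasing sequences.
A finite partition `x₀ < x₁ < ⋯ < xₙ` of a compact interval `[x₀, xₙ]`, with multiple knots at
the two ends, is the sequence with `t k = x₀` for `k ≤ 0`, `t k = x_k` for `0 ≤ k ≤ n` and
`t k = xₙ` for `k ≥ n`: all B-splines of degree `m` other than those of index `0, …, n + m - 1`
then vanish identically. -/
structure IsKnotSequence (t : ℤ → ℝ) : Prop where
  monotone : Monotone t
  nonconst : ∃ k l : ℤ, t k < t l

/-- The interval `I` that is partitioned by the knots: the convex hull of the set of knots.
An end point belongs to `I` exactly when it is a knot. -/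
def knotInterval (t : ℤ → ℝ) : Set ℝ := {x | ∃ k l : ℤ, t k ≤ x ∧ x ≤ t l}

open Classical in
/-- The Cox–de Boor recursion: `coxDeBoor t d i` is the normalized B-spline of degree `d` with
knots `t i, …, t (i + d + 1)`. In the recursion a quotient with zero denominator is `0`.
The functions of degree `0` are the indicators of `[t i, t (i + 1))`, except that the last
nondegenerate interval is closed on the right if the knots have a largest element. -/
def coxDeBoor (t : ℤ → ℝ) : ℕ → ℤ → ℝ → ℝ
  | 0, i, x =>
      if (t i ≤ x ∧ x < t (i + 1)) ∨ (t i < x ∧ x = t (i + 1) ∧ ∀ l : ℤ, t l ≤ x) then 1 else 0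
  | d + 1, i, x =>
      (x - t i) / (t (i + d + 1) - t i) * coxDeBoor t d i x
        + (t (i + d + 2) - x) / (t (i + d + 2) - t (i + 1)) * coxDeBoor t d (i + 1) x

/-- The B-spline `B_j` of degree `m`, with support `[t (j - m), t (j + 1)]`. -/
def bspline (m : ℕ) (t : ℤ → ℝ) (j : ℤ) (x : ℝ) : ℝ := coxDeBoor t m (j - m) x

/-- The index set `E_m = {-m + 1, …, 0}`. -/
def indexSet (m : ℕ) : Finset ℤ := Finset.Icc (-(m : ℤ) + 1) 0

/-- The Greville point `θ_j`: the mean of the knots `t (j - m + 1), …, t j`. -/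
def greville (m : ℕ) (t : ℤ → ℝ) (j : ℤ) : ℝ :=
  (∑ r ∈ indexSet m, t (j + r)) / m

/-- `θ_j^{(2)}`: the normalized second elementary symmetric function of the same knots. -/
def grevilleTwo (m : ℕ) (t : ℤ → ℝ) (j : ℤ) : ℝ :=
  (∑ s ∈ indexSet m, ∑ r ∈ indexSet m with r < s, t (j + r) * t (j + s)) / (m.choose 2 : ℝ)

/-- `A_j^{(2)} = θ_j ^ 2 - θ_j^{(2)}`. -/
def grevilleGap (m : ℕ) (t : ℤ → ℝ) (j : ℤ) : ℝ :=
  greville m t j ^ 2 - grevilleTwo m t j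

/-- The second-order divided difference `[x, y, z] f` (for pairwise distinct points). -/
def dividedDiffTwo (f : ℝ → ℝ) (x y z : ℝ) : ℝ := (slope f y z - slope f x y) / (z - x)

/-- The coefficient functional `λ_j^{(2)}` of the differential quasi-interpolant. -/
def diffCoeff (m : ℕ) (t : ℤ → ℝ) (j : ℤ) (f : ℝ → ℝ) : ℝ :=
  f (greville m t j) - 1 / 2 * grevilleGap m t j * iteratedDeriv 2 f (greville m t j)

/-- The coefficient functional `μ_j^{(2)}` of the discrete quasi-interpolant. If two of the three
Greville points coincide, the knots `t (j - m + 1), …, t j` coincide, so that `A_j^{(2)} = 0` and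
`μ_j^{(2)} f = f (θ_j)`. -/
def discreteCoeff (m : ℕ) (t : ℤ → ℝ) (j : ℤ) (f : ℝ → ℝ) : ℝ :=
  f (greville m t j) - grevilleGap m t j *
    dividedDiffTwo f (greville m t (j - 1)) (greville m t j) (greville m t (j + 1))

/-- The discrete quasi-interpolant `Q₂^* f = ∑ j, μ_j^{(2)}(f) B_j`. At each point of the interval
only finitely many B-splines are nonzero. -/
def discreteQI (m : ℕ) (t : ℤ → ℝ) (f : ℝ → ℝ) (x : ℝ) : ℝ :=
  ∑ᶠ j : ℤ, discreteCoeff m t j f * bspline m t j x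

/-- The sup norm of `f` on `I`, with values in `[0, ∞]`. -/
def supNormOn (I : Set ℝ) (f : ℝ → ℝ) : ℝ≥0∞ := ⨆ x ∈ I, ‖f x‖ₑ

/-- The norm `‖Q‖_∞` that the sup norm on `I` induces on an operator `Q`. All functions bounded
by `1` on `I` are admitted, in particular the continuous ones. -/
def opSupNorm (I : Set ℝ) (Q : (ℝ → ℝ) → ℝ → ℝ) : ℝ≥0∞ :=
  ⨆ (f : ℝ → ℝ) (_ : supNormOn I f ≤ 1), supNormOn I (Q f)

end SplineQI

end

/-! Summing the Cox–de Boor recursion by parts turns a degree `d + 1` B-spline series into one of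
degree `d` (`finsum_mul_coxDeBoor_succ`). Induction with coefficients 1, e₁ and 2e₂ of the interior
knots gives Marsden's identity up to degree 2: the series with coefficients 1, θ_j, θ_j^{(2)} sum to
1, x, x². Since [x,y,z] of a + bx + cx² is c, half its second derivative, μ_j and λ_j both send it
to a + bθ_j + cθ_j^{(2)}; this gives reproduction.

For the norm, B_j ≥ 0 and ∑ B_j = 1 reduce matters to |μ_j(f)| ≤ 1 + 2A_j / ((θ_j − θ_{j−1})(θ_{j+1}
− θ_j)). With w = t_j − t_{j−m+1}, each Greville gap is at least w/m, while A_j is a scaled variance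
of the same m knots. The sharp Popoviciu bound then yields 2A_j ≤ ⌊(m+2)/2⌋(w/m)², so the constant
is 1 + ⌊(m+2)/2⌋. -/

namespace SplineQI

open Finset

/-! ### Degree zero: exactly one indicator is active at each point -/

section DegreeZero

variable {t : ℤ → ℝ} {x : ℝ}

theorem IsKnotSequence.exists_coxDeBoor_zero (ht : IsKnotSequence t) (hx : x ∈ knotInterval t) :
    ∃ k : ℤ, coxDeBoor t 0 k x = 1 := by
  obtain ⟨k, l, hk, hl⟩ := hx
  -- If x is the largest knot, half-open intervals miss it; the last nondegenerate interval, closed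
  -- on the right, catches it.
  by_cases hmax : ∀ n : ℤ, t n ≤ x
  · have hxl : x = t l := le_antisymm hl (hmax l)
    obtain ⟨a, b, hab⟩ := ht.nonconst
    have ha : t a < x := hab.trans_le (hmax b)
    obtain ⟨i, hi, hmaxi⟩ := Int.exists_greatest_of_bdd (P := fun i => t i < x)
      ⟨l, fun z hz => by
        by_contra h
        have := ht.monotone (not_le.1 h).le
        linarith⟩ ⟨a, ha⟩
    refine ⟨i, ?_⟩
    have h1 : x ≤ t (i + 1) := by
      by_contra h
      have := hmaxi (i + 1) (not_le.1 h)
      omega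
    simp only [coxDeBoor]
    rw [if_pos]
    exact Or.inr ⟨hi, le_antisymm h1 (hmax _), hmax⟩
  · push Not at hmax
    obtain ⟨n, hn⟩ := hmax
    obtain ⟨i, hi, hmaxi⟩ := Int.exists_greatest_of_bdd (P := fun i => t i ≤ x)
      ⟨n, fun z hz => by
        by_contra h
        have := ht.monotone (not_le.1 h).le
        linarith⟩ ⟨k, hk⟩
    refine ⟨i, ?_⟩
    have h1 : x < t (i + 1) := by
      by_contra h
      have := hmaxi (i + 1) (not_lt.1 h)
      omega
    simp only [coxDeBoor]
    rw [if_pos]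
    exact Or.inl ⟨hi, h1⟩

theorem coxDeBoor_zero_ne_zero_iff {i : ℤ} : coxDeBoor t 0 i x ≠ 0 ↔
    (t i ≤ x ∧ x < t (i + 1)) ∨ (t i < x ∧ x = t (i + 1) ∧ ∀ l : ℤ, t l ≤ x) := by
  simp only [coxDeBoor, ne_eq, ite_eq_right_iff, one_ne_zero, imp_false, not_not]

theorem coxDeBoor_zero_index_le (ht : Monotone t) {i k : ℤ}
    (hi : coxDeBoor t 0 i x ≠ 0) (hk : coxDeBoor t 0 k x ≠ 0) : i ≤ k := by
  rw [coxDeBoor_zero_ne_zero_iff] at hi hk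
  by_contra h
  have hki : t (k + 1) ≤ t i := ht (by omega)
  rcases hi with ⟨h1, h2⟩ | ⟨h1, h2, h3⟩ <;> rcases hk with ⟨h4, h5⟩ | ⟨h4, h5, h6⟩
  · linarith
  · linarith [h6 (i + 1)]
  · linarith
  · linarith

theorem coxDeBoor_zero_index_unique (ht : Monotone t) {i k : ℤ}
    (hi : coxDeBoor t 0 i x ≠ 0) (hk : coxDeBoor t 0 k x ≠ 0) : i = k :=
  le_antisymm (coxDeBoor_zero_index_le ht hi hk) (coxDeBoor_zero_index_le ht hk hi)

end DegreeZero

/-! ### Local support, finiteness and positivity -/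

section Support

variable {t : ℤ → ℝ} {x : ℝ}

theorem exists_coxDeBoor_zero_ne_zero {d : ℕ} : ∀ {i : ℤ}, coxDeBoor t d i x ≠ 0 →
    ∃ k : ℤ, i ≤ k ∧ k ≤ i + d ∧ coxDeBoor t 0 k x ≠ 0 := by
  induction d with
  | zero => exact fun {i} h => ⟨i, le_rfl, by simp, h⟩
  | succ d ih =>
    intro i h
    have h' : coxDeBoor t d i x ≠ 0 ∨ coxDeBoor t d (i + 1) x ≠ 0 := by
      by_contra hc
      push Not at hc
      exact h (by simp [coxDeBoor, hc.1, hc.2])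
    rcases h' with h' | h'
    · obtain ⟨k, h1, h2, h3⟩ := ih h'
      exact ⟨k, h1, by push_cast; omega, h3⟩
    · obtain ⟨k, h1, h2, h3⟩ := ih h'
      exact ⟨k, by omega, by push_cast; omega, h3⟩

theorem coxDeBoor_ne_zero_bounds (ht : Monotone t) {d : ℕ} {i : ℤ}
    (h : coxDeBoor t d i x ≠ 0) :
    t i ≤ x ∧ x ≤ t (i + d + 1) ∧ t i < t (i + d + 1) := by
  obtain ⟨k, h1, h2, h3⟩ := exists_coxDeBoor_zero_ne_zero h
  have h4 : t i ≤ t k := ht h1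
  have h5 : t (k + 1) ≤ t (i + d + 1) := ht (by omega)
  rw [coxDeBoor_zero_ne_zero_iff] at h3
  rcases h3 with ⟨h6, h7⟩ | ⟨h6, h7, -⟩
  · exact ⟨by linarith, by linarith, by linarith⟩
  · exact ⟨by linarith, by linarith, by linarith⟩

theorem finite_coxDeBoor_ne_zero (ht : Monotone t) (d : ℕ) (x : ℝ) :
    {i : ℤ | coxDeBoor t d i x ≠ 0}.Finite := by
  by_cases hne : ∃ k, coxDeBoor t 0 k x ≠ 0
  · obtain ⟨k, hk⟩ := hne
    refine (Set.finite_Icc (k - d) k).subset fun i hi => ?_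
    obtain ⟨l, h1, h2, h3⟩ := exists_coxDeBoor_zero_ne_zero hi
    obtain rfl := coxDeBoor_zero_index_unique ht h3 hk
    exact ⟨by omega, h1⟩
  · convert Set.finite_empty
    ext i
    simp only [Set.mem_ofPred_eq, Set.mem_empty_iff_false, iff_false]
    intro hi
    obtain ⟨l, -, -, h3⟩ := exists_coxDeBoor_zero_ne_zero hi
    exact hne ⟨l, h3⟩

theorem coxDeBoor_nonneg (ht : Monotone t) (d : ℕ) : ∀ i : ℤ, 0 ≤ coxDeBoor t d i x := by
  induction d with
  | zero => intro i; simp only [coxDeBoor]; split_ifs <;> norm_num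
  | succ d ih =>
    intro i
    simp only [coxDeBoor]
    apply add_nonneg
    · by_cases h : coxDeBoor t d i x = 0
      · simp [h]
      · have hb := coxDeBoor_ne_zero_bounds ht h
        exact mul_nonneg (div_nonneg (by linarith) (by linarith)) (ih i)
    · by_cases h : coxDeBoor t d (i + 1) x = 0
      · simp [h]
      · have hb := coxDeBoor_ne_zero_bounds ht h
        rw [show i + 1 + (d : ℤ) + 1 = i + d + 2 by ring] at hb
        exact mul_nonneg (div_nonneg (by linarith) (by linarith)) (ih _)

theorem finite_support_mul_coxDeBoor (ht : Monotone t) (d : ℕ) (x : ℝ) (c : ℤ → ℝ) :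
    (Function.support fun i => c i * coxDeBoor t d i x).Finite :=
  (finite_coxDeBoor_ne_zero ht d x).subset fun _ hi => right_ne_zero_of_mul hi

end Support

/-! ### Marsden's identity up to degree two -/

section Moments

variable {t : ℤ → ℝ} {x : ℝ}

/-- Shifting the index in the second term of the recursion gathers `c i` and `c (i - 1)` on the same
degree `d` spline. The condition on `e` is their weighted mean with denominators cleared; it is
needed only on nondegenerate supports, as the spline vanishes otherwise. -/
theorem finsum_mul_coxDeBoor_succ (ht : Monotone t) (d : ℕ) (c e : ℤ → ℝ)
    (hce : ∀ i, t i < t (i + d + 1) →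
      (x - t i) * c i + (t (i + d + 1) - x) * c (i - 1) = (t (i + d + 1) - t i) * e i) :
    ∑ᶠ i, c i * coxDeBoor t (d + 1) i x = ∑ᶠ i, e i * coxDeBoor t d i x := by
  have hshift : ∑ᶠ i, c i * ((t (i + d + 2) - x) / (t (i + d + 2) - t (i + 1)) *
        coxDeBoor t d (i + 1) x) =
      ∑ᶠ i, (c (i - 1) * ((t (i + d + 1) - x) / (t (i + d + 1) - t i))) * coxDeBoor t d i x := by
    rw [← finsum_comp_equiv (Equiv.addRight (1 : ℤ))
      (f := fun i => (c (i - 1) * ((t (i + d + 1) - x) / (t (i + d + 1) - t i))) *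
        coxDeBoor t d i x)]
    refine finsum_congr fun i => ?_
    simp only [Equiv.coe_addRight, add_sub_cancel_right]
    rw [show i + 1 + (d : ℤ) + 1 = i + d + 2 by ring, mul_assoc]
  have hfin : (Function.support fun i => c i * ((t (i + d + 2) - x) /
      (t (i + d + 2) - t (i + 1)) * coxDeBoor t d (i + 1) x)).Finite := by
    refine ((finite_coxDeBoor_ne_zero ht d x).preimage
      (add_left_injective (1 : ℤ)).injOn).subset fun i hi => ?_
    exact right_ne_zero_of_mul (right_ne_zero_of_mul hi)
  have hsplit : ∀ i, c i * coxDeBoor t (d + 1) i x =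
      (c i * ((x - t i) / (t (i + d + 1) - t i))) * coxDeBoor t d i x +
      c i * ((t (i + d + 2) - x) / (t (i + d + 2) - t (i + 1)) * coxDeBoor t d (i + 1) x) := by
    intro i
    simp only [coxDeBoor]
    ring
  rw [finsum_congr hsplit, finsum_add_distrib (finite_support_mul_coxDeBoor ht d x _) hfin,
    hshift, ← finsum_add_distrib (finite_support_mul_coxDeBoor ht d x _)
      (finite_support_mul_coxDeBoor ht d x _)]
  refine finsum_congr fun i => ?_
  by_cases h : coxDeBoor t d i x = 0
  · simp [h]
  · have hlt := (coxDeBoor_ne_zero_bounds ht h).2.2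
    have hne : t (i + d + 1) - t i ≠ 0 := by linarith
    rw [← add_mul]
    congr 1
    rw [eq_comm, ← mul_right_inj' hne, ← hce i hlt]
    field_simp

/-- The `p`-th power sum of the `d` knots `t (i + 1), …, t (i + d)`. -/
def knotPowerSum (t : ℤ → ℝ) (p d : ℕ) (i : ℤ) : ℝ := ∑ k ∈ range d, t (i + 1 + k) ^ p

theorem knotPowerSum_succ (t : ℤ → ℝ) (p d : ℕ) (i : ℤ) :
    knotPowerSum t p (d + 1) i = knotPowerSum t p d i + t (i + d + 1) ^ p := by
  simp only [knotPowerSum, sum_range_succ]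
  rw [show i + 1 + (d : ℤ) = i + d + 1 by ring]

theorem knotPowerSum_succ_sub_one (t : ℤ → ℝ) (p d : ℕ) (i : ℤ) :
    knotPowerSum t p (d + 1) (i - 1) = knotPowerSum t p d i + t i ^ p := by
  simp only [knotPowerSum, sum_range_succ']
  congr 1
  · refine sum_congr rfl fun k _ => ?_
    congr 2
    push_cast
    ring
  · simp

theorem IsKnotSequence.finsum_coxDeBoor (ht : IsKnotSequence t) (hx : x ∈ knotInterval t) (d : ℕ) :
    ∑ᶠ i, coxDeBoor t d i x = 1 := by
  induction d with
  | zero =>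
    obtain ⟨k, hk⟩ := ht.exists_coxDeBoor_zero hx
    rw [finsum_eq_single _ k, hk]
    intro i hi
    by_contra h
    exact hi (coxDeBoor_zero_index_unique ht.monotone h (by rw [hk]; exact one_ne_zero))
  | succ d ih =>
    have := finsum_mul_coxDeBoor_succ (x := x) ht.monotone d (fun _ => 1) (fun _ => 1)
      (fun i _ => by ring)
    simpa [ih] using this

theorem IsKnotSequence.finsum_knotPowerSum_one_mul_coxDeBoor (ht : IsKnotSequence t)
    (hx : x ∈ knotInterval t) (d : ℕ) :
    ∑ᶠ i, knotPowerSum t 1 d i * coxDeBoor t d i x = d * x := by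
  induction d with
  | zero => simp [knotPowerSum]
  | succ d ih =>
    rw [finsum_mul_coxDeBoor_succ ht.monotone d _ (fun i => knotPowerSum t 1 d i + x)]
    · simp only [add_mul]
      rw [finsum_add_distrib (finite_support_mul_coxDeBoor ht.monotone d x _)
        (finite_support_mul_coxDeBoor ht.monotone d x _), ih, ← mul_finsum,
        ht.finsum_coxDeBoor hx]
      push_cast
      ring
    · intro i _
      rw [knotPowerSum_succ, knotPowerSum_succ_sub_one]
      ring

/-- The coefficient is 2e₂ of the interior knots. Lowering the degree replaces one knot by x, and
2e₂ with x adjoined is 2e₂ + 2x e₁. -/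
theorem IsKnotSequence.finsum_knotPowerSum_two_mul_coxDeBoor (ht : IsKnotSequence t)
    (hx : x ∈ knotInterval t) (d : ℕ) :
    ∑ᶠ i, (knotPowerSum t 1 d i ^ 2 - knotPowerSum t 2 d i) * coxDeBoor t d i x =
      d * (d - 1) * x ^ 2 := by
  induction d with
  | zero => simp [knotPowerSum]
  | succ d ih =>
    rw [finsum_mul_coxDeBoor_succ ht.monotone d _ (fun i =>
      (knotPowerSum t 1 d i ^ 2 - knotPowerSum t 2 d i) + 2 * x * knotPowerSum t 1 d i)]
    · simp only [add_mul]
      rw [finsum_add_distrib (finite_support_mul_coxDeBoor ht.monotone d x _)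
        (finite_support_mul_coxDeBoor ht.monotone d x _), ih]
      simp only [mul_assoc (2 * x)]
      rw [← mul_finsum, ht.finsum_knotPowerSum_one_mul_coxDeBoor hx]
      push_cast
      ring
    · intro i _
      rw [knotPowerSum_succ, knotPowerSum_succ, knotPowerSum_succ_sub_one,
        knotPowerSum_succ_sub_one]
      ring

end Moments

/-! ### Greville points through power sums -/

section Greville

variable {m : ℕ} {t : ℤ → ℝ}

theorem sum_indexSet (m : ℕ) (g : ℤ → ℝ) :
    ∑ r ∈ indexSet m, g r = ∑ k ∈ range m, g (-(m : ℤ) + 1 + k) := by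
  symm
  refine sum_bij (fun k _ => -(m : ℤ) + 1 + k) ?_ ?_ ?_ ?_
  · intro k hk
    simp only [indexSet, mem_Icc, mem_range] at *
    omega
  · intro a _ b _ h
    simpa using h
  · intro r hr
    simp only [indexSet, mem_Icc] at hr
    exact ⟨(r + m - 1).toNat, by simp only [mem_range]; omega, by omega⟩
  · exact fun _ _ => rfl

theorem sum_indexSet_knots_pow (m : ℕ) (t : ℤ → ℝ) (p : ℕ) (j : ℤ) :
    ∑ r ∈ indexSet m, t (j + r) ^ p = knotPowerSum t p m (j - m) := by
  rw [sum_indexSet m fun r => t (j + r) ^ p, knotPowerSum]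
  refine sum_congr rfl fun k _ => ?_
  congr 2
  ring

theorem two_mul_sum_sum_filter_lt_mul (s : Finset ℤ) (g : ℤ → ℝ) :
    2 * ∑ b ∈ s, ∑ a ∈ s with a < b, g a * g b = (∑ a ∈ s, g a) ^ 2 - ∑ a ∈ s, g a ^ 2 := by
  have hswap : ∑ b ∈ s, ∑ a ∈ s with a < b, g a * g b =
      ∑ b ∈ s, ∑ a ∈ s with b < a, g a * g b := by
    simp only [sum_filter]
    rw [sum_comm]
    refine sum_congr rfl fun a _ => sum_congr rfl fun b _ => ?_
    rw [mul_comm]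
  rw [two_mul]
  nth_rewrite 2 [hswap]
  rw [eq_sub_iff_add_eq, sq, sum_mul_sum, ← sum_add_distrib, ← sum_add_distrib]
  refine sum_congr rfl fun b hb => ?_
  have hd : g b ^ 2 = ∑ a ∈ s, if a = b then g a * g b else 0 := by
    rw [sum_ite_eq' s b, if_pos hb, sq]
  rw [hd, sum_filter, sum_filter, ← sum_add_distrib, ← sum_add_distrib]
  refine sum_congr rfl fun a _ => ?_
  rcases lt_trichotomy a b with h | h | h
  · simp [h, h.not_gt, h.ne, mul_comm]
  · simp [h]
  · simp [h, h.not_gt, h.ne', mul_comm]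

theorem greville_eq (m : ℕ) (t : ℤ → ℝ) (j : ℤ) :
    greville m t j = knotPowerSum t 1 m (j - m) / m := by
  rw [greville, ← sum_indexSet_knots_pow]
  simp

theorem grevilleTwo_eq (m : ℕ) (t : ℤ → ℝ) (j : ℤ) :
    grevilleTwo m t j =
      (knotPowerSum t 1 m (j - m) ^ 2 - knotPowerSum t 2 m (j - m)) / (m * (m - 1)) := by
  rw [grevilleTwo, Nat.cast_choose_two, ← sum_indexSet_knots_pow, ← sum_indexSet_knots_pow]
  simp only [pow_one]
  rw [← two_mul_sum_sum_filter_lt_mul (indexSet m) fun r => t (j + r), div_div_eq_mul_div, mul_comm]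

/-- This exhibits A_j as ∑ (t_i − θ_j)² / (m(m − 1)) over the m knots that define θ_j. -/
theorem grevilleGap_eq (hm : 2 ≤ m) (t : ℤ → ℝ) (j : ℤ) :
    grevilleGap m t j =
      (m * knotPowerSum t 2 m (j - m) - knotPowerSum t 1 m (j - m) ^ 2) / (m ^ 2 * (m - 1)) := by
  have hm' : (2 : ℝ) ≤ m := by exact_mod_cast hm
  have h1 : (m : ℝ) - 1 ≠ 0 := by linarith
  have h0 : (m : ℝ) ≠ 0 := by linarith
  rw [grevilleGap, greville_eq, grevilleTwo_eq]
  field_simp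
  ring

/-- Consecutive windows of m knots differ by one knot entering and one leaving. -/
theorem greville_add_one_sub (hm : 2 ≤ m) (t : ℤ → ℝ) (j : ℤ) :
    greville m t (j + 1) - greville m t j = (t (j + 1) - t (j + 1 - m)) / m := by
  obtain ⟨n, rfl⟩ : ∃ n, m = n + 1 := ⟨m - 1, by omega⟩
  rw [greville_eq, greville_eq, ← sub_div, knotPowerSum_succ,
    show j - ((n + 1 : ℕ) : ℤ) = j + 1 - (n + 1 : ℕ) - 1 by ring, knotPowerSum_succ_sub_one]
  rw [show j + 1 - ((n + 1 : ℕ) : ℤ) + n + 1 = j + 1 by push_cast; ring]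
  ring

theorem greville_mem_knotInterval (ht : Monotone t) (hm : 2 ≤ m) (j : ℤ) :
    greville m t j ∈ knotInterval t := by
  have hm' : (0 : ℝ) < m := by exact_mod_cast (by omega : 0 < m)
  refine ⟨j - m, j, ?_, ?_⟩ <;> rw [greville_eq, knotPowerSum]
  · rw [le_div_iff₀ hm', mul_comm]
    have := card_nsmul_le_sum (range m) (fun k : ℕ => t (j - m + 1 + k) ^ 1) (t (j - m))
      fun k _ => by rw [pow_one]; exact ht (by omega)
    simpa using this
  · rw [div_le_iff₀ hm', mul_comm]
    have := sum_le_card_nsmul (range m) (fun k : ℕ => t (j - m + 1 + k) ^ 1) (t j)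
      fun k hk => by
        rw [mem_range] at hk
        rw [pow_one]; exact ht (by omega)
    simpa using this

end Greville

/-! ### Variance of the knots against gaps of Greville points -/

section Variance

/-- A sharp discrete form of Popoviciu's inequality on variances. -/
theorem card_mul_sum_sq_sub_sq_sum_le (m : ℕ) : ∀ (u : ℕ → ℝ) (a b : ℝ), Monotone u →
    (∀ k < m, a ≤ u k ∧ u k ≤ b) →
    m * ∑ k ∈ range m, u k ^ 2 - (∑ k ∈ range m, u k) ^ 2 ≤ ((m ^ 2 / 4 : ℕ) : ℝ) * (b - a) ^ 2 := by
  induction m using Nat.twoStepInduction with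
  | zero => intro u a b _ _; simp
  | one => intro u a b _ _; simp
  -- Peel off the smallest and largest values, p and q. The left side grows by (q − p)² plus the sum
  -- over inner v of (v − p)² + (v − q)² ≤ (q − p)², hence by at most (m + 1)(q − p)²; this matches
  -- the growth of ⌊m²/4⌋.
  | more m ih _ =>
    intro u a b hu hab
    have ih' := ih (fun k => u (k + 1)) (u 0) (u (m + 1)) (fun i j h => hu (by omega))
      fun k hk => ⟨hu (by omega), hu (by omega)⟩
    have hcard : ((m + 2) ^ 2 / 4 : ℕ) = m ^ 2 / 4 + (m + 1) := by
      rw [show (m + 2) ^ 2 = m ^ 2 + (m + 1) * 4 by ring, Nat.add_mul_div_right _ _ (by norm_num)]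
    have hsum : ∑ k ∈ range m, ((u (k + 1) - u 0) ^ 2 + (u (k + 1) - u (m + 1)) ^ 2) ≤
        m * (u (m + 1) - u 0) ^ 2 := by
      have := sum_le_card_nsmul (range m)
        (fun k => (u (k + 1) - u 0) ^ 2 + (u (k + 1) - u (m + 1)) ^ 2) ((u (m + 1) - u 0) ^ 2)
        fun k hk => by
          rw [mem_range] at hk
          have h1 : u 0 ≤ u (k + 1) := hu (by omega)
          have h2 : u (k + 1) ≤ u (m + 1) := hu (by omega)
          nlinarith [mul_nonneg (sub_nonneg.2 h1) (sub_nonneg.2 h2)]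
      simpa using this
    have hexp : ∑ k ∈ range m, ((u (k + 1) - u 0) ^ 2 + (u (k + 1) - u (m + 1)) ^ 2) =
        2 * ∑ k ∈ range m, u (k + 1) ^ 2 - 2 * (u 0 + u (m + 1)) * ∑ k ∈ range m, u (k + 1) +
          m * (u 0 ^ 2 + u (m + 1) ^ 2) := by
      have hc : (m : ℝ) * (u 0 ^ 2 + u (m + 1) ^ 2) =
          ∑ k ∈ range m, (u 0 ^ 2 + u (m + 1) ^ 2) := by
        rw [sum_const, card_range, nsmul_eq_mul]
      rw [hc, mul_sum, mul_sum, ← sum_sub_distrib, ← sum_add_distrib]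
      exact sum_congr rfl fun k _ => by ring
    have hwidth : (u (m + 1) - u 0) ^ 2 ≤ (b - a) ^ 2 := by
      have h0 := hab 0 (by omega)
      have h1 := hab (m + 1) (by omega)
      have h2 : u 0 ≤ u (m + 1) := hu (by omega)
      exact pow_le_pow_left₀ (by linarith) (by linarith) 2
    have hmono : (((m + 2) ^ 2 / 4 : ℕ) : ℝ) * (u (m + 1) - u 0) ^ 2 ≤
        (((m + 2) ^ 2 / 4 : ℕ) : ℝ) * (b - a) ^ 2 :=
      mul_le_mul_of_nonneg_left hwidth (Nat.cast_nonneg _)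
    refine le_trans ?_ hmono
    rw [hcard, sum_range_succ _ (m + 1), sum_range_succ _ (m + 1), sum_range_succ' _ m,
      sum_range_succ' _ m]
    push_cast
    linarith

/-- Equality for odd m; for m = 2n with n ≥ 1 the slack is n − 1. The floor in the final constant
comes from here. -/
theorem two_mul_sq_div_four_le (m : ℕ) :
    2 * (m ^ 2 / 4) ≤ (m + 2) / 2 * (m - 1) := by
  obtain ⟨n, rfl | rfl⟩ := m.even_or_odd'
  · rw [show (2 * n) ^ 2 = n ^ 2 * 4 by ring, Nat.mul_div_cancel _ (by norm_num),
      show (2 * n + 2) / 2 = n + 1 by omega]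
    rcases n with _ | n
    · simp
    · rw [show 2 * (n + 1) - 1 = 2 * n + 1 by omega]
      nlinarith
  · rw [show (2 * n + 1) ^ 2 = 1 + (n ^ 2 + n) * 4 by ring,
      Nat.add_mul_div_right _ _ (by norm_num), show (2 * n + 1 + 2) / 2 = n + 1 by omega,
      Nat.add_sub_cancel]
    norm_num
    nlinarith

variable {m : ℕ} {t : ℤ → ℝ}

theorem grevilleGap_nonneg (hm : 2 ≤ m) (t : ℤ → ℝ) (j : ℤ) : 0 ≤ grevilleGap m t j := by
  have hm' : (2 : ℝ) ≤ m := by exact_mod_cast hm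
  rw [grevilleGap_eq hm]
  refine div_nonneg ?_ (mul_nonneg (by positivity) (by linarith))
  have := sq_sum_le_card_mul_sum_sq (s := range m) (f := fun k : ℕ => t (j - m + 1 + k))
  simp only [card_range] at this
  simpa [knotPowerSum] using this

theorem two_mul_grevilleGap_le (ht : Monotone t) (hm : 2 ≤ m) (j : ℤ) :
    2 * grevilleGap m t j ≤ ((m + 2) / 2 : ℕ) * ((t j - t (j - m + 1)) / m) ^ 2 := by
  have hm' : (2 : ℝ) ≤ m := by exact_mod_cast hm
  have hV := card_mul_sum_sq_sub_sq_sum_le m (fun k => t (j - m + 1 + k)) (t (j - m + 1)) (t j)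
    (fun a b h => ht (by omega)) fun k hk => ⟨ht (by omega), ht (by omega)⟩
  have hN : 2 * ((m ^ 2 / 4 : ℕ) : ℝ) ≤ ((m + 2) / 2 : ℕ) * ((m : ℝ) - 1) := by
    have := two_mul_sq_div_four_le m
    have h1 : ((m - 1 : ℕ) : ℝ) = (m : ℝ) - 1 := by rw [Nat.cast_sub (by omega), Nat.cast_one]
    rw [← h1]
    exact_mod_cast this
  rw [grevilleGap_eq hm, div_pow, ← mul_div_assoc, ← mul_div_assoc, div_le_div_iff₀
    (mul_pos (by positivity) (by linarith)) (by positivity)]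
  simp only [knotPowerSum, pow_one]
  have hprod := mul_le_mul_of_nonneg_right hN (sq_nonneg (t j - t (j - m + 1)))
  have hmain : 2 * (m * ∑ k ∈ range m, t (j - m + 1 + k) ^ 2 -
      (∑ k ∈ range m, t (j - m + 1 + k)) ^ 2) ≤
      ((m + 2) / 2 : ℕ) * ((m : ℝ) - 1) * (t j - t (j - m + 1)) ^ 2 := by linarith
  have := mul_le_mul_of_nonneg_right hmain (sq_nonneg (m : ℝ))
  linarith

theorem knots_lt_of_grevilleGap_ne_zero (ht : Monotone t) (hm : 2 ≤ m) {j : ℤ}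
    (hA : grevilleGap m t j ≠ 0) : t (j - m + 1) < t j := by
  refine lt_of_le_of_ne (ht (by omega)) fun h => hA ?_
  have := two_mul_grevilleGap_le ht hm j
  rw [h] at this
  have h0 := grevilleGap_nonneg hm t j
  simp only [sub_self, zero_div] at this
  norm_num at this
  linarith

theorem knot_width_le_greville_add_one_sub (ht : Monotone t) (hm : 2 ≤ m) (j : ℤ) :
    (t j - t (j - m + 1)) / m ≤ greville m t (j + 1) - greville m t j := by
  rw [greville_add_one_sub hm, show j + 1 - (m : ℤ) = j - m + 1 by ring]
  have := ht (show j ≤ j + 1 by omega)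
  gcongr

theorem knot_width_le_greville_sub_sub_one (ht : Monotone t) (hm : 2 ≤ m) (j : ℤ) :
    (t j - t (j - m + 1)) / m ≤ greville m t j - greville m t (j - 1) := by
  have h := greville_add_one_sub hm t (j - 1)
  rw [sub_add_cancel] at h
  rw [h]
  have := ht (show j - m ≤ j - m + 1 by omega)
  gcongr

end Variance

/-! ### The coefficient functionals: quadratics and bounds -/

section Coefficients

variable {m : ℕ} {t : ℤ → ℝ}

theorem dividedDiffTwo_quadratic (a b c : ℝ) {x y z : ℝ} (hxy : x < y) (hyz : y < z) :
    dividedDiffTwo (fun x => a + b * x + c * x ^ 2) x y z = c := by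
  have h1 : y - x ≠ 0 := by linarith
  have h2 : z - y ≠ 0 := by linarith
  have h3 : z - x ≠ 0 := by linarith
  simp only [dividedDiffTwo, slope_def_field]
  field_simp
  ring

/-- The weights of `f x` and `f z` have the same sign, and their sizes add up to the weight at y, A
/ ((y − x)(z − y)); hence the factor 2. -/
theorem abs_sub_mul_dividedDiffTwo_le {f : ℝ → ℝ} {x y z A : ℝ} (hxy : x < y) (hyz : y < z)
    (hA : 0 ≤ A) (hx : |f x| ≤ 1) (hy : |f y| ≤ 1) (hz : |f z| ≤ 1) :
    |f y - A * dividedDiffTwo f x y z| ≤ 1 + 2 * A / ((y - x) * (z - y)) := by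
  have h1 : 0 < y - x := by linarith
  have h2 : 0 < z - y := by linarith
  have h3 : 0 < z - x := by linarith
  have key : f y - A * dividedDiffTwo f x y z =
      f y + (A / ((y - x) * (z - y))) * f y - (A / ((y - x) * (z - x))) * f x
        - (A / ((z - y) * (z - x))) * f z := by
    simp only [dividedDiffTwo, slope_def_field]
    field_simp
    ring
  have hsum : A / ((y - x) * (z - x)) + A / ((z - y) * (z - x)) = A / ((y - x) * (z - y)) := by
    field_simp
    ring
  have hbound : ∀ p v : ℝ, 0 ≤ p → |v| ≤ 1 → |p * v| ≤ p := fun p v hp hv => by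
    rw [abs_mul, abs_of_nonneg hp]
    exact mul_le_of_le_one_right hp hv
  have b1 := hbound _ _ (show 0 ≤ A / ((y - x) * (z - y)) by positivity) hy
  have b2 := hbound _ _ (show 0 ≤ A / ((y - x) * (z - x)) by positivity) hx
  have b3 := hbound _ _ (show 0 ≤ A / ((z - y) * (z - x)) by positivity) hz
  rw [key, mul_div_assoc]
  rw [abs_le] at *
  constructor <;> linarith [b1.1, b1.2, b2.1, b2.2, b3.1, b3.2]

theorem greville_lt_of_grevilleGap_ne_zero (ht : Monotone t) (hm : 2 ≤ m) {j : ℤ}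
    (hA : grevilleGap m t j ≠ 0) :
    greville m t (j - 1) < greville m t j ∧ greville m t j < greville m t (j + 1) := by
  have hw : 0 < (t j - t (j - m + 1)) / m :=
    div_pos (sub_pos.2 (knots_lt_of_grevilleGap_ne_zero ht hm hA))
      (by exact_mod_cast (by omega : 0 < m))
  exact ⟨by linarith [knot_width_le_greville_sub_sub_one ht hm j],
    by linarith [knot_width_le_greville_add_one_sub ht hm j]⟩

theorem discreteCoeff_quadratic (ht : Monotone t) (hm : 2 ≤ m) (j : ℤ) (a b c : ℝ) :
    discreteCoeff m t j (fun x => a + b * x + c * x ^ 2) =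
      a + b * greville m t j + c * grevilleTwo m t j := by
  have hgap : grevilleGap m t j = greville m t j ^ 2 - grevilleTwo m t j := rfl
  by_cases hA : grevilleGap m t j = 0
  -- Greville points may coincide here, but the divided difference is multiplied by 0, and θ_j² =
  -- θ_j^{(2)}.
  · rw [discreteCoeff, hA]
    rw [hA, eq_comm, sub_eq_zero] at hgap
    rw [hgap]
    ring
  · obtain ⟨h1, h2⟩ := greville_lt_of_grevilleGap_ne_zero ht hm hA
    rw [discreteCoeff, dividedDiffTwo_quadratic a b c h1 h2, hgap]
    ring

theorem diffCoeff_quadratic (m : ℕ) (t : ℤ → ℝ) (j : ℤ) (a b c : ℝ) :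
    diffCoeff m t j (fun x => a + b * x + c * x ^ 2) =
      a + b * greville m t j + c * grevilleTwo m t j := by
  have hd : deriv (fun x : ℝ => a + b * x + c * x ^ 2) = fun x => b + c * (2 * x) := by
    funext x
    have h := (((hasDerivAt_id x).const_mul b).const_add a).add
      (((hasDerivAt_id x).pow 2).const_mul c)
    have h' : HasDerivAt (fun x : ℝ => a + b * x + c * x ^ 2) (b + c * (2 * x)) x :=
      h.congr_deriv (by simp)
    exact h'.deriv
  have hdd : iteratedDeriv 2 (fun x : ℝ => a + b * x + c * x ^ 2) = fun _ => 2 * c := by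
    rw [iteratedDeriv_succ, iteratedDeriv_one, hd]
    funext x
    have h' : HasDerivAt (fun x : ℝ => b + c * (2 * x)) (2 * c) x :=
      ((((hasDerivAt_id x).const_mul 2).const_mul c).const_add b).congr_deriv (by ring)
    exact h'.deriv
  rw [diffCoeff, hdd, grevilleGap]
  ring

theorem abs_discreteCoeff_le (ht : Monotone t) (hm : 2 ≤ m) (j : ℤ) {f : ℝ → ℝ}
    (hf : ∀ x ∈ knotInterval t, |f x| ≤ 1) :
    |discreteCoeff m t j f| ≤ ((m + 4) / 2 : ℕ) := by
  have hfθ : ∀ j, |f (greville m t j)| ≤ 1 := fun j => hf _ (greville_mem_knotInterval ht hm j)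
  have hcast : (((m + 4) / 2 : ℕ) : ℝ) = 1 + ((m + 2) / 2 : ℕ) := by
    rw [show (m + 4) / 2 = 1 + (m + 2) / 2 by omega]
    push_cast
    ring
  rw [hcast]
  by_cases hA : grevilleGap m t j = 0
  · rw [discreteCoeff, hA, zero_mul, sub_zero]
    exact (hfθ j).trans (le_add_of_nonneg_right (Nat.cast_nonneg _))
  · obtain ⟨h1, h2⟩ := greville_lt_of_grevilleGap_ne_zero ht hm hA
    refine (abs_sub_mul_dividedDiffTwo_le h1 h2 (grevilleGap_nonneg hm t j)
      (hfθ _) (hfθ _) (hfθ _)).trans ?_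
    have hw : 0 < (t j - t (j - m + 1)) / m :=
      div_pos (sub_pos.2 (knots_lt_of_grevilleGap_ne_zero ht hm hA))
        (by exact_mod_cast (by omega : 0 < m))
    gcongr
    rw [div_le_iff₀ (mul_pos (by linarith) (by linarith))]
    refine (two_mul_grevilleGap_le ht hm j).trans ?_
    rw [sq]
    exact mul_le_mul_of_nonneg_left (mul_le_mul (knot_width_le_greville_sub_sub_one ht hm j)
      (knot_width_le_greville_add_one_sub ht hm j) hw.le (by linarith)) (Nat.cast_nonneg _)

end Coefficients

/-! ### Reproduction of quadratics and the norm bound -/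

section QuasiInterpolant

variable {m : ℕ} {t : ℤ → ℝ} {x : ℝ}

theorem finsum_mul_bspline (m : ℕ) (t : ℤ → ℝ) (x : ℝ) (c : ℤ → ℝ) :
    ∑ᶠ j : ℤ, c (j - m) * bspline m t j x = ∑ᶠ i, c i * coxDeBoor t m i x := by
  rw [← finsum_comp_equiv (Equiv.subRight (m : ℤ)) (f := fun i => c i * coxDeBoor t m i x)]
  rfl

theorem finite_bspline_ne_zero (ht : Monotone t) (m : ℕ) (x : ℝ) :
    {j : ℤ | bspline m t j x ≠ 0}.Finite :=
  (finite_coxDeBoor_ne_zero ht m x).preimage (sub_left_injective (b := (m : ℤ))).injOn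

theorem finite_support_mul_bspline (ht : Monotone t) (m : ℕ) (x : ℝ) (c : ℤ → ℝ) :
    (Function.support fun j => c j * bspline m t j x).Finite :=
  (finite_bspline_ne_zero ht m x).subset fun _ hi => right_ne_zero_of_mul hi

theorem IsKnotSequence.finsum_bspline (ht : IsKnotSequence t) (hx : x ∈ knotInterval t) (m : ℕ) :
    ∑ᶠ j, bspline m t j x = 1 := by
  simpa [ht.finsum_coxDeBoor hx] using finsum_mul_bspline m t x fun _ => 1

theorem IsKnotSequence.finsum_greville_mul_bspline (ht : IsKnotSequence t)
    (hx : x ∈ knotInterval t) (hm : 2 ≤ m) :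
    ∑ᶠ j, greville m t j * bspline m t j x = x := by
  have hm' : (2 : ℝ) ≤ m := by exact_mod_cast hm
  have h0 : (m : ℝ) ≠ 0 := by linarith
  simp only [greville_eq, div_eq_inv_mul, mul_assoc]
  rw [← mul_finsum,
    finsum_mul_bspline m t x (knotPowerSum t 1 m),
    ht.finsum_knotPowerSum_one_mul_coxDeBoor hx]
  field_simp

theorem IsKnotSequence.finsum_grevilleTwo_mul_bspline (ht : IsKnotSequence t)
    (hx : x ∈ knotInterval t) (hm : 2 ≤ m) :
    ∑ᶠ j, grevilleTwo m t j * bspline m t j x = x ^ 2 := by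
  have hm' : (2 : ℝ) ≤ m := by exact_mod_cast hm
  have h0 : (m : ℝ) ≠ 0 := by linarith
  have h1 : (m : ℝ) - 1 ≠ 0 := by linarith
  simp only [grevilleTwo_eq, div_eq_inv_mul, mul_assoc _ _ (bspline m t _ x)]
  rw [← mul_finsum,
    finsum_mul_bspline m t x fun i => knotPowerSum t 1 m i ^ 2 - knotPowerSum t 2 m i,
    ht.finsum_knotPowerSum_two_mul_coxDeBoor hx]
  field_simp

theorem IsKnotSequence.discreteQI_quadratic (ht : IsKnotSequence t) (hx : x ∈ knotInterval t)
    (hm : 2 ≤ m) (a b c : ℝ) :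
    discreteQI m t (fun y => a + b * y + c * y ^ 2) x = a + b * x + c * x ^ 2 := by
  have hfin := finite_support_mul_bspline ht.monotone m x
  have hsplit : ∀ j, discreteCoeff m t j (fun y => a + b * y + c * y ^ 2) * bspline m t j x =
      a * bspline m t j x + b * (greville m t j * bspline m t j x) +
        c * (grevilleTwo m t j * bspline m t j x) := fun j => by
    rw [discreteCoeff_quadratic ht.monotone hm]
    ring
  rw [discreteQI, finsum_congr hsplit, finsum_add_distrib, finsum_add_distrib,
    ← mul_finsum, ← mul_finsum,
    ← mul_finsum, ht.finsum_bspline hx, ht.finsum_greville_mul_bspline hx hm,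
    ht.finsum_grevilleTwo_mul_bspline hx hm, mul_one]
  · exact hfin _
  · simpa only [Function.HasFiniteSupport, mul_assoc] using hfin fun j => b * greville m t j
  · simpa only [Function.HasFiniteSupport, mul_assoc, add_mul] using
      hfin fun j => a + b * greville m t j
  · simpa only [Function.HasFiniteSupport, mul_assoc] using hfin fun j => c * grevilleTwo m t j

theorem IsKnotSequence.abs_discreteQI_le (ht : IsKnotSequence t) (hx : x ∈ knotInterval t)
    (hm : 2 ≤ m) {f : ℝ → ℝ} (hf : ∀ x ∈ knotInterval t, |f x| ≤ 1) :
    |discreteQI m t f x| ≤ ((m + 4) / 2 : ℕ) := by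
  have hfin := finite_bspline_ne_zero ht.monotone m x
  have hB : ∑ j ∈ hfin.toFinset, bspline m t j x = 1 := by
    rw [← ht.finsum_bspline hx m]
    exact (finsum_eq_sum_of_support_subset _ fun j hj => by simpa using hj).symm
  rw [discreteQI, finsum_eq_sum_of_support_subset (s := hfin.toFinset) _
    fun j hj => by simpa using right_ne_zero_of_mul hj]
  refine (abs_sum_le_sum_abs _ _).trans ?_
  -- Spread the constant over the partition of unity to compare termwise.
  rw [← mul_one (((m + 4) / 2 : ℕ) : ℝ), ← hB, mul_sum]
  refine sum_le_sum fun j _ => ?_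
  have h0 : 0 ≤ bspline m t j x := coxDeBoor_nonneg ht.monotone m _
  rw [abs_mul, abs_of_nonneg h0]
  exact mul_le_mul_of_nonneg_right (abs_discreteCoeff_le ht.monotone hm j hf) h0

theorem IsKnotSequence.opSupNorm_discreteQI_le (ht : IsKnotSequence t) (hm : 2 ≤ m) :
    opSupNorm (knotInterval t) (discreteQI m t) ≤ (((m + 4) / 2 : ℕ) : ℝ≥0∞) := by
  refine iSup₂_le fun f hf => iSup₂_le fun x hx => ?_
  have hf' : ∀ y ∈ knotInterval t, |f y| ≤ 1 := fun y hy => by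
    have h : ‖f y‖ₑ ≤ 1 := (le_iSup₂ (f := fun z (_ : z ∈ knotInterval t) => ‖f z‖ₑ) y hy).trans hf
    rwa [← ofReal_norm, ENNReal.ofReal_le_one] at h
  rw [← ofReal_norm, ← ENNReal.ofReal_natCast]
  exact ENNReal.ofReal_le_ofReal (ht.abs_discreteQI_le hx hm hf')

theorem exists_eval_eq_quadratic {p : Polynomial ℝ} (hp : p.natDegree ≤ 2) :
    ∃ a b c : ℝ, (fun x => p.eval x) = fun x => a + b * x + c * x ^ 2 := by
  refine ⟨p.coeff 0, p.coeff 1, p.coeff 2, funext fun x => ?_⟩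
  rw [Polynomial.eval_eq_sum_range' (show p.natDegree < 3 by omega)]
  simp [sum_range_succ]

end QuasiInterpolant

end SplineQI

theorem theorem1 (m : ℕ) (hm : 2 ≤ m) (t : ℤ → ℝ) (ht : SplineQI.IsKnotSequence t) :
    (∀ x ∈ SplineQI.knotInterval t, {j : ℤ | SplineQI.bspline m t j x ≠ 0}.Finite) ∧
    (∀ p : Polynomial ℝ, p.natDegree ≤ 2 →
      (∀ j : ℤ, SplineQI.discreteCoeff m t j (fun x => p.eval x) =
        SplineQI.diffCoeff m t j (fun x => p.eval x)) ∧
      ∀ x ∈ SplineQI.knotInterval t,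
        SplineQI.discreteQI m t (fun y => p.eval y) x = p.eval x) ∧
    SplineQI.opSupNorm (SplineQI.knotInterval t) (SplineQI.discreteQI m t) ≤
      ((⌊((m : ℝ) + 4) / 2⌋₊ : ℕ) : ENNReal) := by
  have hmono := ht.monotone
  refine ⟨fun x _ => SplineQI.finite_bspline_ne_zero hmono m x, fun p hp => ?_, ?_⟩
  · obtain ⟨a, b, c, h⟩ := SplineQI.exists_eval_eq_quadratic hp
    refine ⟨fun j => ?_, fun x hx => ?_⟩
    · rw [h, SplineQI.discreteCoeff_quadratic hmono hm, SplineQI.diffCoeff_quadratic]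
    · rw [h, ht.discreteQI_quadratic hx hm]
      exact (congrFun h x).symm
  · have hfloor : ⌊((m : ℝ) + 4) / 2⌋₊ = (m + 4) / 2 := by
      have h := Nat.floor_div_eq_div (K := ℝ) (m + 4) 2
      push_cast at h
      exact h
    rw [hfloor]
    exact ht.opSupNorm_discreteQI_le hm
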